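/- A birth-death process on $\mathbb{N}=\{0,1,2,\dots\}$ with birth rates $(\lambda_x)$ and death rates $(\nu_x)$, $\nu_0=0$, is a (non-explosive) Markov process with right-continuous paths having left limits, whose transition probabilities $P_t(x,y)$ satisfy, as $t\to0^+$, $P_t(x,x+1)=\lambda_x t+o(t)$, $P_t(x,x-1)=\nu_x t+o(t)$ (for $x\ge1$) and $P_t(x,x)=1-(\lambda_x+\nu_x)t+o(t)$. For a positive function $u$ on $\mathbb{N}$, its $u$-modification is the birth-death process with birth rates $\lambda^u_x=\frac{u_{x+1}}{u_x}\lambda_{x+1}$ and death rates $\nu^u_x=\frac{u_{x-1}}{u_x}\nu_x$ (with $\nu^u_0=0$). Let $0<\lambda<\nu$ and consider the positive recurrent (ergodic) M/M/1 queue, i.e. the birth-death process with rates $\lambda_x=\lambda$ and $\nu_x=\nu\mathbf{1}_{\{x\ge1\}}$. Fix $x\in\mathbb{N}$, let $(X^{x+1}_t)_{t\ge0}$ be this process started at $x+1$, and let $T_0^{x+1}=\inf\{t>0: X^{x+1}_t=0\}$. Let $u_y=u(y)=(\nu/\lambda)^{y/2}\ge1$ for $y\in\mathbb{N}$, and let $(X^x_{u,t})_{t\ge0}$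 be the $u$-modification of the M/M/1 queue, started at $x$. Then for every $t\ge0$, $$\mathbb{P}(T_0^{x+1}>t)=u_x\,e^{-t(\sqrt\lambda-\sqrt\nu)^2}\;\mathbb{E}\left[\frac{1}{u(X^x_{u,t})}\exp\left(-\sqrt{\lambda\nu}\int_0^t\mathbf{1}_{\{0\}}(X^x_{u,s})\,ds\right)\right]\le u_x\,e^{-t(\sqrt\lambda-\sqrt\nu)^2}.$$ -/

import Mathlib

open MeasureTheory Filter Topology Asymptotics
open scoped NNReal ENNReal

namespace BirthDeath

/-- `p t x y` is the (honest) transition function of a birth-death Markov semigroup on `ℕ` with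
birth rates `lam` and death rates `nu`: a stochastic semigroup with
`p t x (x + 1) = lam x * t + o(t)`, `p t x (x - 1) = nu x * t + o(t)` and
`p t x x = 1 - (lam x + nu x) * t + o(t)` as `t → 0+`. -/
structure IsTransitionFunction (lam nu : ℕ → ℝ) (p : ℝ≥0 → ℕ → ℕ → ℝ) : Prop where
  death_zero : nu 0 = 0
  nonneg : ∀ t x y, 0 ≤ p t x y
  hasSum_one : ∀ t x, HasSum (fun y => p t x y) 1
  zero : ∀ x y, p 0 x y = if x = y then 1 else 0
  semigroup : ∀ s t x y, HasSum (fun z => p s x z * p t z y) (p (s + t) x y)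
  birth : ∀ x, (fun t : ℝ≥0 => p t x (x + 1) - lam x * (t : ℝ)) =o[𝓝[>] 0] fun t => (t : ℝ)
  death : ∀ x, (fun t : ℝ≥0 => p t (x + 1) x - nu (x + 1) * (t : ℝ)) =o[𝓝[>] 0] fun t => (t : ℝ)
  stay : ∀ x, (fun t : ℝ≥0 => p t x x - (1 - (lam x + nu x) * (t : ℝ)))
    =o[𝓝[>] 0] fun t => (t : ℝ)

/-- `X` is a (non-explosive) birth-death process on `ℕ` under `P`, with birth rates `lam` and death
rates `nu`, started at `x`: its paths are almost surely right-continuous with left limits (for the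
discrete topology of `ℕ`), and it is a Markov process with transition function as above,
expressed by the finite-dimensional distributions. -/
structure IsProcess {Ω : Type*} [MeasurableSpace Ω] (P : Measure Ω) (lam nu : ℕ → ℝ) (x : ℕ)
    (X : ℝ≥0 → Ω → ℕ) : Prop where
  measurable : ∀ t, Measurable (X t)
  cadlag : ∀ᵐ ω ∂P, ∀ t : ℝ≥0, ContinuousWithinAt (fun s => X s ω) (Set.Ici t) t ∧
    ∃ l : ℕ, Tendsto (fun s => X s ω) (𝓝[<] t) (𝓝 l)
  markov : ∃ p : ℝ≥0 → ℕ → ℕ → ℝ, IsTransitionFunction lam nu p ∧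
    ∀ (n : ℕ) (t : ℕ → ℝ≥0) (a : ℕ → ℕ), t 0 = 0 → Monotone t →
      P.real {ω | ∀ i ≤ n, X (t i) ω = a i} =
        (if a 0 = x then 1 else 0) *
          ∏ i ∈ Finset.range n, p (t (i + 1) - t i) (a i) (a (i + 1))

/-- Birth rates of the `u`-modification. -/
noncomputable def modBirth (u lam : ℕ → ℝ) (x : ℕ) : ℝ := u (x + 1) / u x * lam (x + 1)

/-- Death rates of the `u`-modification (at `x = 0` the rate is `0`, because `nu 0 = 0`). -/
noncomputable def modDeath (u nu : ℕ → ℝ) (x : ℕ) : ℝ := u (x - 1) / u x * nu x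

/-- Birth rates of the M/M/1 queue. -/
def mm1Birth (lam : ℝ) (_ : ℕ) : ℝ := lam

/-- Death rates of the M/M/1 queue. -/
def mm1Death (nu : ℝ) (x : ℕ) : ℝ := if x = 0 then 0 else nu

/-- The weight `u x = (nu / lam) ^ (x / 2)`. -/
noncomputable def weight (lam nu : ℝ) (x : ℕ) : ℝ := (nu / lam) ^ ((x : ℝ) / 2)

/-- The hitting time `inf {t > 0 : X t = 0}` of the origin, with `inf ∅ = ∞`. -/
noncomputable def hitZero {Ω : Type*} (X : ℝ≥0 → Ω → ℕ) (ω : Ω) : ℝ≥0∞ :=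
  ⨅ (t : ℝ≥0) (_ : 0 < t ∧ X t ω = 0), (t : ℝ≥0∞)

end BirthDeath

/-! Write `s = √(λν)`, `c = (√λ - √ν)²` and `v = 1/u`. The `u`-modification is again an M/M/1 queue,
with both rates equal to `s`. Killing the original queue at `0` and shifting the state by one gives
an operator on functions on `ℕ`; conjugating it by `v` gives the generator of the modified queue
minus the potential `c + s 1_{0}`. This is `gen_mm1_intertwine`, which rests on `λ + ν = c + 2s`.
The potential accounts for both exponentials in the formula, and the final factor `1/u` is `v`
applied to the terminal state.

The identity passes from generators to processes by time discretisation. On a grid of mesh `h` in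
`[0, t]`, the finite-dimensional distributions turn both sides into iterates of one-step operators
(`integral_prod_eq_iterate_weightedSemi`). The rates are bounded, so a uniform second-order Taylor
bound (`abs_semi_sub_gen_le`) makes the intertwining hold up to `O(h²)` per step. The steps are
contractions, so the total error is `O(t h)`. As `h → 0`, right-continuity makes the grid
functionals converge to the indicator of `T_0 > t` and to the Feynman-Kac weight. The inequality
follows because the integrand is at most `1`. -/

namespace BirthDeath

/-! ### Semigroup, generator and Taylor bounds -/

/-- The action `f ↦ ∑ y, p t x y * f y` of a transition function on functions. -/
noncomputable def semi (p : ℝ≥0 → ℕ → ℕ → ℝ) (t : ℝ≥0) (f : ℕ → ℝ) (x : ℕ) : ℝ :=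
  ∑' y, p t x y * f y

/-- The generator of a birth-death process. -/
def gen (lam nu f : ℕ → ℝ) (x : ℕ) : ℝ :=
  lam x * (f (x + 1) - f x) + nu x * (f (x - 1) - f x)

theorem gen_sub (lam nu f g : ℕ → ℝ) (x : ℕ) :
    gen lam nu (fun y => f y - g y) x = gen lam nu f x - gen lam nu g x := by
  unfold gen; ring

theorem abs_gen_le {lam nu f : ℕ → ℝ} {q M : ℝ} (hl : ∀ x, 0 ≤ lam x) (hn : ∀ x, 0 ≤ nu x)
    (hq : ∀ x, lam x + nu x ≤ q) (hf : ∀ y, |f y| ≤ M) (x : ℕ) :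
    |gen lam nu f x| ≤ 2 * q * M := by
  have hM : 0 ≤ M := (abs_nonneg _).trans (hf 0)
  have key : ∀ y, |f y - f x| ≤ 2 * M := fun y =>
    (abs_sub _ _).trans (by linarith [hf y, hf x])
  calc |gen lam nu f x| ≤ lam x * (2 * M) + nu x * (2 * M) := by
        refine (abs_add_le _ _).trans (add_le_add ?_ ?_)
        · rw [abs_mul, abs_of_nonneg (hl x)]
          exact mul_le_mul_of_nonneg_left (key _) (hl x)
        · rw [abs_mul, abs_of_nonneg (hn x)]
          exact mul_le_mul_of_nonneg_left (key _) (hn x)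
    _ = (lam x + nu x) * (2 * M) := by ring
    _ ≤ q * (2 * M) := mul_le_mul_of_nonneg_right (hq x) (by positivity)
    _ = 2 * q * M := by ring

namespace IsTransitionFunction

variable {lam nu : ℕ → ℝ} {p : ℝ≥0 → ℕ → ℕ → ℝ}

theorem summable_mul (hp : IsTransitionFunction lam nu p) {f : ℕ → ℝ} {M : ℝ}
    (hf : ∀ y, |f y| ≤ M) (t : ℝ≥0) (x : ℕ) : Summable fun y => p t x y * f y := by
  refine Summable.of_norm_bounded ((hp.hasSum_one t x).summable.mul_right M) fun y => ?_
  rw [Real.norm_eq_abs, abs_mul, abs_of_nonneg (hp.nonneg t x y)]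
  exact mul_le_mul_of_nonneg_left (hf y) (hp.nonneg t x y)

theorem hasSum_semi (hp : IsTransitionFunction lam nu p) {f : ℕ → ℝ} {M : ℝ}
    (hf : ∀ y, |f y| ≤ M) (t : ℝ≥0) (x : ℕ) :
    HasSum (fun y => p t x y * f y) (semi p t f x) :=
  (hp.summable_mul hf t x).hasSum

theorem abs_semi_le (hp : IsTransitionFunction lam nu p) {f : ℕ → ℝ} {M : ℝ}
    (hf : ∀ y, |f y| ≤ M) (t : ℝ≥0) (x : ℕ) : |semi p t f x| ≤ M := by
  have h1 := (hp.hasSum_one t x).mul_right M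
  rw [one_mul] at h1
  refine (hp.hasSum_semi hf t x).norm_le_of_bounded h1 fun y => ?_
  rw [Real.norm_eq_abs, abs_mul, abs_of_nonneg (hp.nonneg t x y)]
  exact mul_le_mul_of_nonneg_left (hf y) (hp.nonneg t x y)

theorem semi_sub (hp : IsTransitionFunction lam nu p) {f g : ℕ → ℝ} {M N : ℝ}
    (hf : ∀ y, |f y| ≤ M) (hg : ∀ y, |g y| ≤ N) (t : ℝ≥0) (x : ℕ) :
    semi p t (fun y => f y - g y) x = semi p t f x - semi p t g x := by
  have := (hp.hasSum_semi hf t x).sub (hp.hasSum_semi hg t x)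
  simp only [← mul_sub] at this
  exact this.tsum_eq

theorem semi_zero (hp : IsTransitionFunction lam nu p) (f : ℕ → ℝ) (x : ℕ) :
    semi p 0 f x = f x := by
  unfold semi
  rw [tsum_eq_single x]
  · simp [hp.zero]
  · intro y hy; simp [hp.zero, hy.symm]

theorem semi_add (hp : IsTransitionFunction lam nu p) {f : ℕ → ℝ} {M : ℝ}
    (hf : ∀ y, |f y| ≤ M) (s t : ℝ≥0) (x : ℕ) :
    semi p (s + t) f x = semi p s (semi p t f) x := by
  have hS : Summable fun a : ℕ × ℕ => p s x a.1 * p t a.1 a.2 * f a.2 := by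
    have h0 : Summable fun a : ℕ × ℕ => p s x a.1 * p t a.1 a.2 := by
      refine (summable_prod_of_nonneg (f := fun a : ℕ × ℕ => p s x a.1 * p t a.1 a.2)
        fun a => mul_nonneg (hp.nonneg s x a.1) (hp.nonneg t a.1 a.2)).2
        ⟨fun z => (hp.hasSum_one t z).summable.mul_left (p s x z), ?_⟩
      simp only [tsum_mul_left, (hp.hasSum_one t _).tsum_eq, mul_one]
      exact (hp.hasSum_one s x).summable
    refine Summable.of_norm_bounded (h0.mul_right M) fun a => ?_
    have := mul_nonneg (hp.nonneg s x a.1) (hp.nonneg t a.1 a.2)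
    rw [Real.norm_eq_abs, abs_mul, abs_of_nonneg this]
    exact mul_le_mul_of_nonneg_left (hf _) this
  calc semi p (s + t) f x = ∑' y, ∑' z, p s x z * p t z y * f y := by
        refine tsum_congr fun y => ?_
        rw [← (hp.semigroup s t x y).tsum_eq, tsum_mul_right]
    _ = ∑' z, ∑' y, p s x z * p t z y * f y :=
        Summable.tsum_comm (f := fun z y => p s x z * p t z y * f y) hS
    _ = semi p s (semi p t f) x := by
        refine tsum_congr fun z => ?_
        simp only [semi, mul_assoc, tsum_mul_left]

theorem le_one (hp : IsTransitionFunction lam nu p) (t : ℝ≥0) (x y : ℕ) : p t x y ≤ 1 :=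
  le_hasSum (hp.hasSum_one t x) y fun z _ => hp.nonneg t x z

/-- The transition probability `p t x (x - 1)` downwards, which is `0` at the origin. -/
def down (p : ℝ≥0 → ℕ → ℕ → ℝ) (t : ℝ≥0) (x : ℕ) : ℝ := if x = 0 then 0 else p t x (x - 1)

theorem hasSum_down (p : ℝ≥0 → ℕ → ℕ → ℝ) (t : ℝ≥0) (x : ℕ) (c : ℝ) :
    HasSum (fun y => p t x y * if y + 1 = x then c else 0) (down p t x * c) := by
  rcases x with _ | x
  · simp [down]
  · have := hasSum_ite_eq x (p t (x + 1) x * c)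
    simp only [down, Nat.add_sub_cancel, Nat.add_right_cancel_iff, Nat.add_one_ne_zero, if_false]
    convert this using 2 with y
    split_ifs with h <;> simp_all

theorem hasSum_single_mul (p : ℝ≥0 → ℕ → ℕ → ℝ) (t : ℝ≥0) (x z : ℕ) (c : ℝ) :
    HasSum (fun y => p t x y * if y = z then c else 0) (p t x z * c) := by
  have := hasSum_ite_eq z (p t x z * c)
  convert this using 2 with y
  split_ifs with h <;> simp_all

/-- Once staying put and the jumps to neighbours are removed, each remaining target contributes at
most `2 * M` times its probability. -/
theorem abs_semi_sub_jumps_le (hp : IsTransitionFunction lam nu p) {f : ℕ → ℝ} {M : ℝ}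
    (hf : ∀ y, |f y| ≤ M) (t : ℝ≥0) (x : ℕ) :
    |semi p t f x - f x - (p t x (x + 1) * (f (x + 1) - f x) + down p t x * (f (x - 1) - f x))|
      ≤ (1 - p t x x - p t x (x + 1) - down p t x) * (2 * M) := by
  have h1 : HasSum (fun y => p t x y * (f y - f x - (if y = x + 1 then f (x + 1) - f x else 0)
      - if y + 1 = x then f (x - 1) - f x else 0))
      (semi p t f x - f x - p t x (x + 1) * (f (x + 1) - f x) - down p t x * (f (x - 1) - f x)) := by
    have := (((hp.hasSum_semi hf t x).sub ((hp.hasSum_one t x).mul_right (f x))).sub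
      (hasSum_single_mul p t x (x + 1) (f (x + 1) - f x))).sub (hasSum_down p t x (f (x - 1) - f x))
    simpa only [← mul_sub, one_mul] using this
  have h2 : HasSum (fun y => p t x y * (2 * M - (if y = x then 2 * M else 0)
      - (if y = x + 1 then 2 * M else 0) - if y + 1 = x then 2 * M else 0))
      (1 * (2 * M) - p t x x * (2 * M) - p t x (x + 1) * (2 * M) - down p t x * (2 * M)) := by
    have := ((((hp.hasSum_one t x).mul_right (2 * M)).sub
      (hasSum_single_mul p t x x (2 * M))).sub
      (hasSum_single_mul p t x (x + 1) (2 * M))).sub (hasSum_down p t x (2 * M))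
    simpa only [← mul_sub] using this
  have h3 := h1.norm_le_of_bounded h2 fun y => by
    rw [Real.norm_eq_abs, abs_mul, abs_of_nonneg (hp.nonneg t x y)]
    refine mul_le_mul_of_nonneg_left ?_ (hp.nonneg t x y)
    by_cases e1 : y = x
    · subst e1; simp
    by_cases e2 : y = x + 1
    · subst e2; simp [show x + 1 + 1 ≠ x by omega]
    by_cases e3 : y + 1 = x
    · subst e3; simp [show y ≠ y + 1 + 1 by omega]
    simp only [e1, e2, e3, if_false, sub_zero]
    exact (abs_sub _ _).trans (by linarith [hf y, hf x])
  rw [Real.norm_eq_abs] at h3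
  calc _ = |semi p t f x - f x - p t x (x + 1) * (f (x + 1) - f x)
        - down p t x * (f (x - 1) - f x)| := by congr 1; ring
    _ ≤ _ := h3
    _ = _ := by ring

theorem isLittleO_down (hp : IsTransitionFunction lam nu p) (x : ℕ) :
    (fun t : ℝ≥0 => down p t x - nu x * (t : ℝ)) =o[𝓝[>] 0] fun t => (t : ℝ) := by
  rcases x with _ | x
  · simp only [down, hp.death_zero, if_true, zero_mul, sub_zero]
    exact isLittleO_zero _ _
  · simpa [down] using hp.death x

/-- The birth, death and holding asymptotics add up to `1 + o(t)`, so all other targets together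
carry mass `o(t)`. -/
theorem isLittleO_semi (hp : IsTransitionFunction lam nu p) {f : ℕ → ℝ} {M : ℝ}
    (hf : ∀ y, |f y| ≤ M) (x : ℕ) :
    (fun t : ℝ≥0 => semi p t f x - f x - (t : ℝ) * gen lam nu f x) =o[𝓝[>] 0]
      fun t => (t : ℝ) := by
  have hb := hp.birth x
  have hd := hp.isLittleO_down x
  have hs := hp.stay x
  have h1 : (fun t : ℝ≥0 => semi p t f x - f x - (p t x (x + 1) * (f (x + 1) - f x)
      + down p t x * (f (x - 1) - f x))) =o[𝓝[>] 0] fun t => (t : ℝ) := by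
    have h2 : (fun t : ℝ≥0 => (1 - p t x x - p t x (x + 1) - down p t x) * (2 * M))
        =o[𝓝[>] 0] fun t => (t : ℝ) := by
      have := (((hs.neg_left.sub hb).sub hd).const_mul_left (2 * M))
      refine this.congr_left fun t => ?_
      ring
    refine IsBigO.trans_isLittleO (IsBigO.of_bound 1 (Eventually.of_forall fun t => ?_)) h2
    rw [one_mul]
    exact (hp.abs_semi_sub_jumps_le hf t x).trans (le_abs_self _)
  refine ((h1.add (hb.const_mul_left (f (x + 1) - f x))).add
    (hd.const_mul_left (f (x - 1) - f x))).congr_left fun t => ?_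
  unfold gen
  ring

theorem abs_semi_sub_self_le (hp : IsTransitionFunction lam nu p) {f : ℕ → ℝ} {M : ℝ}
    (hf : ∀ y, |f y| ≤ M) (t : ℝ≥0) (x : ℕ) :
    |semi p t f x - f x| ≤ (1 - p t x x) * (2 * M) := by
  have h1 : HasSum (fun y => p t x y * (f y - f x)) (semi p t f x - f x) := by
    simpa only [← mul_sub, one_mul] using
      (hp.hasSum_semi hf t x).sub ((hp.hasSum_one t x).mul_right (f x))
  have h2 : HasSum (fun y => p t x y * (2 * M - if y = x then 2 * M else 0))
      ((1 - p t x x) * (2 * M)) := by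
    simpa only [← mul_sub, ← sub_mul] using
      ((hp.hasSum_one t x).mul_right (2 * M)).sub (hasSum_single_mul p t x x (2 * M))
  refine h1.norm_le_of_bounded h2 fun y => ?_
  rw [Real.norm_eq_abs, abs_mul, abs_of_nonneg (hp.nonneg t x y)]
  refine mul_le_mul_of_nonneg_left ?_ (hp.nonneg t x y)
  by_cases e1 : y = x
  · subst e1; simp
  simp only [e1, if_false, sub_zero]
  exact (abs_sub _ _).trans (by linarith [hf y, hf x])

theorem tendsto_stay (hp : IsTransitionFunction lam nu p) (x : ℕ) :
    Tendsto (fun t : ℝ≥0 => p t x x) (𝓝 0) (𝓝 1) := by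
  have h0 : Tendsto (fun t : ℝ≥0 => (t : ℝ)) (𝓝[>] 0) (𝓝 0) :=
    (NNReal.continuous_coe.tendsto' 0 0 (by simp)).mono_left nhdsWithin_le_nhds
  have h1 := (hp.stay x).trans_tendsto h0
  have h2 : Tendsto (fun t : ℝ≥0 => 1 - (lam x + nu x) * (t : ℝ)) (𝓝[>] 0) (𝓝 1) := by
    simpa using tendsto_const_nhds.sub (h0.const_mul (lam x + nu x))
  have h3 : Tendsto (fun t : ℝ≥0 => p t x x) (𝓝[>] 0) (𝓝 1) := by
    simpa using h1.add h2
  have h4 : (𝓝 (0 : ℝ≥0)) = 𝓝[>] 0 ⊔ pure 0 := by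
    rw [sup_comm, ← nhdsWithin_insert, nhdsWithin_eq_nhds.2]
    exact Filter.mem_of_superset univ_mem fun t _ => by
      rcases eq_or_lt_of_le (zero_le (a := t)) with h | h
      · exact Or.inl h.symm
      · exact Or.inr h
  rw [h4, tendsto_sup]
  refine ⟨h3, tendsto_pure_left.2 fun s hs => ?_⟩
  have : p 0 x x = 1 := by simp [hp.zero]
  simpa [this] using mem_of_mem_nhds hs

/-- Writing `P_t f = P_{t-s} (P_s f)` puts the short increment first. Only the holding probability
at the fixed state `x` matters, and no uniformity in the state is needed. -/
theorem continuous_semi (hp : IsTransitionFunction lam nu p) {f : ℕ → ℝ} {M : ℝ}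
    (hf : ∀ y, |f y| ≤ M) (x : ℕ) : Continuous fun t : ℝ≥0 => semi p t f x := by
  have key : ∀ s t : ℝ≥0, s ≤ t →
      |semi p t f x - semi p s f x| ≤ (1 - p (t - s) x x) * (2 * M) := fun s t hst => by
    conv_lhs => rw [← tsub_add_cancel_of_le hst, hp.semi_add hf]
    exact hp.abs_semi_sub_self_le (hp.abs_semi_le hf s) _ x
  rw [continuous_iff_continuousAt]
  intro s
  have hM : 0 ≤ M := (abs_nonneg _).trans (hf 0)
  -- Subtraction is truncated, so one of the two nonnegative terms is the relevant bound on each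
  -- side of `s`.
  have ht : Tendsto (fun t : ℝ≥0 => (1 - p (t - s) x x) * (2 * M)
      + (1 - p (s - t) x x) * (2 * M)) (𝓝 s) (𝓝 0) := by
    have a1 : Tendsto (fun t : ℝ≥0 => t - s) (𝓝 s) (𝓝 0) :=
      Continuous.tendsto' (by fun_prop) _ _ (by simp)
    have a2 : Tendsto (fun t : ℝ≥0 => s - t) (𝓝 s) (𝓝 0) :=
      Continuous.tendsto' (by fun_prop) _ _ (by simp)
    have b1 := ((tendsto_const_nhds (x := (1 : ℝ))).sub
      ((hp.tendsto_stay x).comp a1)).mul_const (2 * M)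
    have b2 := ((tendsto_const_nhds (x := (1 : ℝ))).sub
      ((hp.tendsto_stay x).comp a2)).mul_const (2 * M)
    simpa using b1.add b2
  refine tendsto_iff_dist_tendsto_zero.2 (squeeze_zero (fun _ => dist_nonneg) (fun t => ?_) ht)
  have pos : ∀ r, 0 ≤ (1 - p r x x) * (2 * M) := fun r =>
    mul_nonneg (sub_nonneg.2 (hp.le_one r x x)) (by positivity)
  rw [Real.dist_eq]
  rcases le_total s t with h | h
  · linarith [key s t h, pos (s - t)]
  · rw [abs_sub_comm]
    linarith [key t s h, pos (t - s)]

/-- Backward equation: the expansion at time `0+` is applied to the bounded function `P_t f`. It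
yields a right derivative only, which with continuity suffices for the mean value inequality. -/
theorem hasDerivWithinAt_semi (hp : IsTransitionFunction lam nu p) {f : ℕ → ℝ} {M : ℝ}
    (hf : ∀ y, |f y| ≤ M) (x : ℕ) {t : ℝ} (ht : 0 ≤ t) :
    HasDerivWithinAt (fun s : ℝ => semi p s.toNNReal f x)
      (gen lam nu (semi p t.toNNReal f) x) (Set.Ici t) t := by
  rw [← hasDerivWithinAt_Ioi_iff_Ici, hasDerivWithinAt_iff_isLittleO]
  have h1 := hp.isLittleO_semi (hp.abs_semi_le hf t.toNNReal) x
  have h2 : Tendsto (fun s : ℝ => (s - t).toNNReal) (𝓝[>] t) (𝓝[>] 0) := by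
    refine tendsto_nhdsWithin_iff.2 ⟨?_, ?_⟩
    · refine (Continuous.tendsto' ?_ _ _ ?_).mono_left nhdsWithin_le_nhds
      · exact continuous_real_toNNReal.comp (continuous_id.sub continuous_const)
      · simp
    · filter_upwards [self_mem_nhdsWithin] with s hs
      simpa using hs
  refine (h1.comp_tendsto h2).congr' ?_ ?_
  · filter_upwards [self_mem_nhdsWithin] with s hs
    have hs' : 0 ≤ s - t := sub_nonneg.2 (le_of_lt hs)
    have e : s.toNNReal = (s - t).toNNReal + t.toNNReal := by
      rw [← Real.toNNReal_add hs' ht, sub_add_cancel]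
    simp only [Function.comp, e, hp.semi_add hf, Real.coe_toNNReal _ hs', smul_eq_mul]
  · filter_upwards [self_mem_nhdsWithin] with s hs
    have hs' : 0 ≤ s - t := sub_nonneg.2 (le_of_lt hs)
    simp [Real.coe_toNNReal _ hs']

theorem continuous_semi_toNNReal (hp : IsTransitionFunction lam nu p) {f : ℕ → ℝ} {M : ℝ}
    (hf : ∀ y, |f y| ≤ M) (x : ℕ) : Continuous fun t : ℝ => semi p t.toNNReal f x :=
  (hp.continuous_semi hf x).comp continuous_real_toNNReal

theorem abs_semi_sub_self_le_mul (hp : IsTransitionFunction lam nu p) (hl : ∀ x, 0 ≤ lam x)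
    (hn : ∀ x, 0 ≤ nu x) {q : ℝ} (hq : ∀ x, lam x + nu x ≤ q) {f : ℕ → ℝ} {M : ℝ}
    (hf : ∀ y, |f y| ≤ M) (h : ℝ≥0) (x : ℕ) :
    |semi p h f x - f x| ≤ 2 * q * M * h := by
  have := norm_image_sub_le_of_norm_deriv_right_le_segment (a := 0) (b := (h : ℝ))
    (C := 2 * q * M)
    (hp.continuous_semi_toNNReal hf x).continuousOn
    (fun s hs => hp.hasDerivWithinAt_semi hf x hs.1)
    (fun s _ => abs_gen_le hl hn hq (hp.abs_semi_le hf _) x) h ⟨h.2, le_rfl⟩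
  simpa [hp.semi_zero] using this

/-- Second-order Taylor bound for the semigroup of a birth-death process with bounded rates. -/
theorem abs_semi_sub_gen_le (hp : IsTransitionFunction lam nu p) (hl : ∀ x, 0 ≤ lam x)
    (hn : ∀ x, 0 ≤ nu x) {q : ℝ} (hq : ∀ x, lam x + nu x ≤ q) {f : ℕ → ℝ} {M : ℝ}
    (hf : ∀ y, |f y| ≤ M) (h : ℝ≥0) (x : ℕ) :
    |semi p h f x - f x - h * gen lam nu f x| ≤ (2 * q) ^ 2 * M * (h : ℝ) ^ 2 := by
  have hq0 : 0 ≤ q := (add_nonneg (hl 0) (hn 0)).trans (hq 0)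
  have hM : 0 ≤ M := (abs_nonneg _).trans (hf 0)
  -- The remainder has derivative `gen (P_s f - f)`. The first-order bound on `P_s f - f`, followed
  -- by the bound on `gen`, gives the constant.
  have := norm_image_sub_le_of_norm_deriv_right_le_segment (a := 0) (b := (h : ℝ))
    (C := 2 * q * (2 * q * M * h))
    (f := fun s : ℝ => semi p s.toNNReal f x - s * gen lam nu f x)
    (f' := fun s : ℝ => gen lam nu (semi p s.toNNReal f) x - 1 * gen lam nu f x)
    ((hp.continuous_semi_toNNReal hf x).sub (continuous_id.mul continuous_const)).continuousOn
    (fun s hs => (hp.hasDerivWithinAt_semi hf x hs.1).sub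
      ((hasDerivWithinAt_id s _).mul_const _))
    (fun s hs => by
      rw [one_mul, ← gen_sub]
      refine abs_gen_le hl hn hq (fun y => ?_) x
      refine (hp.abs_semi_sub_self_le_mul hl hn hq hf _ y).trans ?_
      rw [Real.coe_toNNReal _ hs.1]
      exact mul_le_mul_of_nonneg_left hs.2.le (by positivity)) h ⟨h.2, le_rfl⟩
  simp only [Real.toNNReal_coe, Real.toNNReal_zero, hp.semi_zero, zero_mul, sub_zero,
    Real.norm_eq_abs] at this
  calc _ = |semi p h f x - h * gen lam nu f x - f x| := by congr 1; ring
    _ ≤ _ := this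
    _ = _ := by ring

end IsTransitionFunction

/-! ### Intertwining of one-step operators -/

/-- One step of the transition function followed by multiplication of the path weight by `φ`. -/
noncomputable def weightedSemi (p : ℝ≥0 → ℕ → ℕ → ℝ) (h : ℝ≥0) (φ f : ℕ → ℝ) : ℕ → ℝ :=
  semi p h fun y => φ y * f y

theorem abs_mul_le_of_abs_le_one {φ f : ℕ → ℝ} {M : ℝ} (hφ : ∀ y, |φ y| ≤ 1)
    (hf : ∀ y, |f y| ≤ M) (y : ℕ) : |φ y * f y| ≤ M := by
  rw [abs_mul]
  exact (mul_le_mul (hφ y) (hf y) (abs_nonneg _) zero_le_one).trans (one_mul M).le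

theorem IsTransitionFunction.abs_weightedSemi_le {lam nu : ℕ → ℝ} {p : ℝ≥0 → ℕ → ℕ → ℝ}
    (hp : IsTransitionFunction lam nu p) {φ f : ℕ → ℝ} {M : ℝ} (hφ : ∀ y, |φ y| ≤ 1)
    (hf : ∀ y, |f y| ≤ M) (h : ℝ≥0) (x : ℕ) : |weightedSemi p h φ f x| ≤ M :=
  hp.abs_semi_le (abs_mul_le_of_abs_le_one hφ hf) h x

theorem IsTransitionFunction.abs_iterate_weightedSemi_le {lam nu : ℕ → ℝ}
    {p : ℝ≥0 → ℕ → ℕ → ℝ} (hp : IsTransitionFunction lam nu p) {φ f : ℕ → ℝ} {M : ℝ}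
    (hφ : ∀ y, |φ y| ≤ 1) (hf : ∀ y, |f y| ≤ M) (h : ℝ≥0) (n x : ℕ) :
    |(weightedSemi p h φ)^[n] f x| ≤ M := by
  induction n generalizing x with
  | zero => exact hf x
  | succ n ih =>
    rw [Function.iterate_succ_apply']
    exact hp.abs_weightedSemi_le hφ ih h x

theorem abs_exp_neg_sub_one_add_le {a : ℝ} (ha : 0 ≤ a) : |Real.exp (-a) - 1 + a| ≤ a ^ 2 := by
  rw [abs_of_nonneg (by linarith [Real.one_sub_le_exp_neg a])]
  rcases le_total a 1 with h | h
  · have := Real.abs_exp_sub_one_sub_id_le (x := -a) (by rwa [abs_neg, abs_of_nonneg ha])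
    have := (abs_le.1 this).2
    rw [neg_sq] at this
    linarith
  · have : Real.exp (-a) ≤ 1 := Real.exp_le_one_iff.2 (by linarith)
    nlinarith

theorem abs_exp_neg_sub_one_le {a : ℝ} (ha : 0 ≤ a) : |Real.exp (-a) - 1| ≤ a := by
  have : Real.exp (-a) ≤ 1 := Real.exp_le_one_iff.2 (by linarith)
  rw [abs_le]
  constructor <;> linarith [Real.one_sub_le_exp_neg a]

/-- The indicator of the positive integers. -/
def posInd (y : ℕ) : ℝ := if y = 0 then 0 else 1

/-- The killing rate `c + s 1_{0}`. -/
def killRate (c s : ℝ) (y : ℕ) : ℝ := if y = 0 then c + s else c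

theorem abs_posInd_le (y : ℕ) : |posInd y| ≤ 1 := by
  unfold posInd; split_ifs <;> simp

theorem killRate_nonneg {c s : ℝ} (hc : 0 ≤ c) (hs : 0 ≤ s) (y : ℕ) : 0 ≤ killRate c s y := by
  unfold killRate; split_ifs <;> linarith

theorem killRate_le {c s : ℝ} (hs : 0 ≤ s) (y : ℕ) : killRate c s y ≤ c + s := by
  unfold killRate; split_ifs <;> linarith

theorem abs_exp_neg_killRate_le {c s h : ℝ} (hc : 0 ≤ c) (hs : 0 ≤ s) (hh : 0 ≤ h) (y : ℕ) :
    |Real.exp (-(killRate c s y * h))| ≤ 1 := by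
  rw [abs_of_pos (Real.exp_pos _), Real.exp_le_one_iff]
  linarith [mul_nonneg (killRate_nonneg hc hs y) hh]

/-- The relations on `v` match the off-diagonal terms, and `hc` matches the diagonal. At `z = 0` the
modified queue has no death term, so its diagonal is `-s` instead of `-2s`; this is the source of
the extra killing rate `s` there. -/
theorem gen_mm1_intertwine {lam nu c s : ℝ} {v : ℕ → ℝ} (h1 : ∀ z, lam * v z = s * v (z + 1))
    (h2 : ∀ z, nu * v (z + 1) = s * v z) (hc : lam + nu = c + 2 * s) (f : ℕ → ℝ) (z : ℕ) :
    v z * gen (mm1Birth lam) (mm1Death nu) (fun y => posInd y * f y) (z + 1) =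
      gen (mm1Birth s) (mm1Death s) (fun y => v y * f (y + 1)) z
        - killRate c s z * (v z * f (z + 1)) := by
  rcases z with _ | z
  · simp only [gen, mm1Birth, mm1Death, posInd, killRate]
    simp
    linear_combination f 2 * h1 0 - v 0 * f 1 * hc
  · simp only [gen, mm1Birth, mm1Death, posInd, killRate]
    simp
    linear_combination f (z + 1 + 1 + 1) * h1 (z + 1) + f (z + 1) * h2 z
      - v (z + 1) * f (z + 1 + 1) * hc

theorem mm1_nonneg {a b : ℝ} (ha : 0 ≤ a) (hb : 0 ≤ b) :
    (∀ x, 0 ≤ mm1Birth a x) ∧ (∀ x, 0 ≤ mm1Death b x) ∧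
      ∀ x, mm1Birth a x + mm1Death b x ≤ a + b := by
  refine ⟨fun x => ha, fun x => ?_, fun x => ?_⟩ <;> unfold mm1Death
  · split_ifs <;> simp [hb]
  · unfold mm1Birth
    split_ifs <;> linarith

/-- The weight `v` intertwines one killed step of the `M/M/1` queue with one step of the
modified queue under the Feynman-Kac weight, up to an error of order `h ^ 2`. -/
theorem abs_weightedSemi_intertwine_le {lam nu c s : ℝ} (hlam : 0 ≤ lam) (hnu : 0 ≤ nu)
    (hc0 : 0 ≤ c) (hs : 0 ≤ s) {v : ℕ → ℝ} (hv0 : ∀ z, 0 ≤ v z) (hv1 : ∀ z, v z ≤ 1)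
    (h1 : ∀ z, lam * v z = s * v (z + 1)) (h2 : ∀ z, nu * v (z + 1) = s * v z)
    (hc : lam + nu = c + 2 * s) {p p' : ℝ≥0 → ℕ → ℕ → ℝ}
    (hp : IsTransitionFunction (mm1Birth lam) (mm1Death nu) p)
    (hp' : IsTransitionFunction (mm1Birth s) (mm1Death s) p')
    {f : ℕ → ℝ} (hf : ∀ y, |f y| ≤ 1) (h : ℝ≥0) (z : ℕ) :
    |v z * weightedSemi p h posInd f (z + 1) -
      weightedSemi p' h (fun y => Real.exp (-(killRate c s y * h))) (fun y => v y * f (y + 1)) z|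
      ≤ ((2 * (lam + nu)) ^ 2 + (2 * (s + s)) ^ 2 + 2 * (s + s) * (c + s) + (c + s) ^ 2)
        * (h : ℝ) ^ 2 := by
  obtain ⟨a1, a2, a3⟩ := mm1_nonneg hlam hnu
  obtain ⟨b1, b2, b3⟩ := mm1_nonneg hs hs
  have hh : (0 : ℝ) ≤ h := h.2
  set g : ℕ → ℝ := fun y => v y * f (y + 1) with hg
  set w : ℕ → ℝ := fun y => Real.exp (-(killRate c s y * h)) with hw
  have hvabs : ∀ y, |v y| ≤ 1 := fun y => by rw [abs_of_nonneg (hv0 y)]; exact hv1 y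
  have hgb : ∀ y, |g y| ≤ 1 := abs_mul_le_of_abs_le_one hvabs fun y => hf (y + 1)
  have hwb : ∀ y, |w y| ≤ 1 := abs_exp_neg_killRate_le hc0 hs hh
  have hk0 := killRate_nonneg hc0 hs
  have hk1 := fun y => killRate_le (c := c) hs y
  have e1 := hp.abs_semi_sub_gen_le a1 a2 a3 (abs_mul_le_of_abs_le_one abs_posInd_le hf) h (z + 1)
  have e2 := hp'.abs_semi_sub_gen_le b1 b2 b3 (abs_mul_le_of_abs_le_one hwb hgb) h z
  -- The Taylor expansion for `p'` involves `gen (w g)`. As `w - 1 = O(h)`, replacing it by `gen g`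
  -- costs `O(h)`, hence `O(h²)` after multiplication by `h`.
  have e3 : |gen (mm1Birth s) (mm1Death s) (fun y => w y * g y - g y) z|
      ≤ 2 * (s + s) * ((c + s) * h) := by
    refine abs_gen_le b1 b2 b3 (fun y => ?_) z
    rw [show w y * g y - g y = (w y - 1) * g y by ring, abs_mul]
    have := abs_exp_neg_sub_one_le (mul_nonneg (hk0 y) hh)
    calc |w y - 1| * |g y| ≤ (killRate c s y * h) * 1 :=
          mul_le_mul this (hgb y) (abs_nonneg _) (mul_nonneg (hk0 y) hh)
      _ ≤ _ := by rw [mul_one]; exact mul_le_mul_of_nonneg_right (hk1 y) hh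
  have e4 : |w z * g z - g z + killRate c s z * h * g z| ≤ (c + s) ^ 2 * (h : ℝ) ^ 2 := by
    rw [show w z * g z - g z + killRate c s z * h * g z
      = (w z - 1 + killRate c s z * h) * g z by ring, abs_mul]
    have := abs_exp_neg_sub_one_add_le (mul_nonneg (hk0 z) hh)
    calc |w z - 1 + killRate c s z * h| * |g z| ≤ (killRate c s z * h) ^ 2 * 1 :=
          mul_le_mul this (hgb z) (abs_nonneg _) (by positivity)
      _ ≤ _ := by
        rw [mul_one, mul_pow]
        gcongr
        · exact hk0 z
        · exact hk1 z
  have e5 := gen_mm1_intertwine h1 h2 hc f z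
  rw [gen_sub] at e3
  simp only [weightedSemi]
  set A := semi p h (fun y => posInd y * f y) (z + 1)
  set B := semi p' h (fun y => w y * g y) z
  set GA := gen (mm1Birth lam) (mm1Death nu) (fun y => posInd y * f y) (z + 1)
  set GB := gen (mm1Birth s) (mm1Death s) (fun y => w y * g y) z
  set GC := gen (mm1Birth s) (mm1Death s) g z
  have e6 : posInd (z + 1) * f (z + 1) = f (z + 1) := by simp [posInd]
  rw [e6] at e1
  have e7 : |v z * (A - f (z + 1) - h * GA)| ≤ (2 * (lam + nu)) ^ 2 * 1 * (h : ℝ) ^ 2 := by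
    rw [abs_mul]
    exact (mul_le_mul (hvabs z) e1 (abs_nonneg _) zero_le_one).trans (one_mul _).le
  have e8 : |h * (GB - GC)| ≤ h * (2 * (s + s) * ((c + s) * h)) := by
    rw [abs_mul, abs_of_nonneg hh]
    exact mul_le_mul_of_nonneg_left e3 hh
  -- Four errors of order `h²` remain: two Taylor remainders, the replacement of `w g` by `g` in the
  -- generator, and the linearisation of the exponential. The terms of order `0` and `1` cancel by
  -- `e5`.
  have key : v z * A - B = v z * (A - f (z + 1) - h * GA) - (B - w z * g z - h * GB)
      - h * (GB - GC) - (w z * g z - g z + killRate c s z * h * g z) := by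
    have : g z = v z * f (z + 1) := rfl
    rw [← this] at e5
    linear_combination h * e5 - this
  rw [key]
  refine (abs_sub _ _).trans ((add_le_add ((abs_sub _ _).trans (add_le_add ((abs_sub _ _).trans
    (add_le_add e7 e2)) e8)) e4).trans (le_of_eq (by ring)))

/-- Each step adds one intertwining error. Earlier errors are not amplified, since a weighted step
is a sup-norm contraction. -/
theorem abs_iterate_weightedSemi_intertwine_le {lam nu c s : ℝ} (hlam : 0 ≤ lam) (hnu : 0 ≤ nu)
    (hc0 : 0 ≤ c) (hs : 0 ≤ s) {v : ℕ → ℝ} (hv0 : ∀ z, 0 ≤ v z) (hv1 : ∀ z, v z ≤ 1)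
    (h1 : ∀ z, lam * v z = s * v (z + 1)) (h2 : ∀ z, nu * v (z + 1) = s * v z)
    (hc : lam + nu = c + 2 * s) {p p' : ℝ≥0 → ℕ → ℕ → ℝ}
    (hp : IsTransitionFunction (mm1Birth lam) (mm1Death nu) p)
    (hp' : IsTransitionFunction (mm1Birth s) (mm1Death s) p') (h : ℝ≥0) (n z : ℕ) :
    |v z * (weightedSemi p h posInd)^[n] (fun _ => 1) (z + 1) -
      (weightedSemi p' h fun y => Real.exp (-(killRate c s y * h)))^[n] v z|
      ≤ n * (((2 * (lam + nu)) ^ 2 + (2 * (s + s)) ^ 2 + 2 * (s + s) * (c + s) + (c + s) ^ 2)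
        * (h : ℝ) ^ 2) := by
  set K := ((2 * (lam + nu)) ^ 2 + (2 * (s + s)) ^ 2 + 2 * (s + s) * (c + s) + (c + s) ^ 2)
        * (h : ℝ) ^ 2 with hK
  set w : ℕ → ℝ := fun y => Real.exp (-(killRate c s y * h)) with hw
  have hwb : ∀ y, |w y| ≤ 1 := abs_exp_neg_killRate_le hc0 hs h.2
  have hvabs : ∀ y, |v y| ≤ 1 := fun y => by rw [abs_of_nonneg (hv0 y)]; exact hv1 y
  induction n generalizing z with
  | zero => simp
  | succ n ih =>
    rw [Function.iterate_succ_apply', Function.iterate_succ_apply']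
    set F := (weightedSemi p h posInd)^[n] fun _ => 1
    set G := (weightedSemi p' h w)^[n] v
    have hF : ∀ y, |F y| ≤ 1 := fun y =>
      hp.abs_iterate_weightedSemi_le abs_posInd_le (fun _ => by simp) h n y
    have hG : ∀ y, |G y| ≤ 1 := fun y => hp'.abs_iterate_weightedSemi_le hwb hvabs h n y
    have e1 := abs_weightedSemi_intertwine_le hlam hnu hc0 hs hv0 hv1 h1 h2 hc hp hp' hF h z
    have e2 : |weightedSemi p' h w (fun y => v y * F (y + 1)) z - weightedSemi p' h w G z|
        ≤ n * K := by
      unfold weightedSemi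
      rw [← hp'.semi_sub (abs_mul_le_of_abs_le_one hwb
        (abs_mul_le_of_abs_le_one hvabs fun y => hF (y + 1))) (abs_mul_le_of_abs_le_one hwb hG)]
      simp only [← mul_sub]
      exact hp'.abs_semi_le (abs_mul_le_of_abs_le_one hwb ih) h z
    refine (abs_sub_le _ _ _).trans ((add_le_add e1 e2).trans (le_of_eq ?_))
    push_cast
    ring

/-! ### Path functionals on a time grid -/

section fdd

/-- The event that the path passes through `a 0, ..., a n` at the times `0, h, ..., n * h`. -/
def gridCylinder {Ω : Type*} (X : ℝ≥0 → Ω → ℕ) (h : ℝ≥0) (n : ℕ) (a : ℕ → ℕ) : Set Ω :=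
  {ω | ∀ i ≤ n, X (i * h) ω = a i}

variable {Ω : Type*} [MeasurableSpace Ω] {P : Measure Ω} [IsProbabilityMeasure P]
  {X : ℝ≥0 → Ω → ℕ}

omit [IsProbabilityMeasure P] in
theorem measurableSet_gridCylinder (hX : ∀ t, Measurable (X t)) (h : ℝ≥0) (n : ℕ) (a : ℕ → ℕ) :
    MeasurableSet (gridCylinder X h n a) := by
  unfold gridCylinder
  simp only [Set.ofPred_forall]
  exact MeasurableSet.iInter fun i => MeasurableSet.iInter fun _ =>
    hX _ (measurableSet_singleton (a i))

/-- The Markov property at time `n * h`: the integral is split over the next value `y`, and the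
cylinder extended by `y` gains one factor `p h (a n) y`. -/
theorem setIntegral_gridCylinder {p : ℝ≥0 → ℕ → ℕ → ℝ} {x : ℕ} (hX : ∀ t, Measurable (X t))
    (hfdd : ∀ (n : ℕ) (t : ℕ → ℝ≥0) (a : ℕ → ℕ), t 0 = 0 → Monotone t →
      P.real {ω | ∀ i ≤ n, X (t i) ω = a i} = (if a 0 = x then 1 else 0) *
        ∏ i ∈ Finset.range n, p (t (i + 1) - t i) (a i) (a (i + 1)))
    {g : ℕ → ℝ} {M : ℝ} (hg : ∀ y, |g y| ≤ M) (h : ℝ≥0) (n : ℕ) (a : ℕ → ℕ) :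
    ∫ ω in gridCylinder X h n a, g (X ((n + 1 : ℕ) * h) ω) ∂P =
      P.real (gridCylinder X h n a) * semi p h g (a n) := by
  have hgrid : ∀ (m : ℕ) (b : ℕ → ℕ), P.real (gridCylinder X h m b) =
      (if b 0 = x then 1 else 0) * ∏ i ∈ Finset.range m, p h (b i) (b (i + 1)) := by
    intro m b
    have := hfdd m (fun i => i * h) b (by simp) fun i j hij => by
      dsimp only; gcongr
    simp only [Nat.cast_add, Nat.cast_one, add_mul, one_mul, add_tsub_cancel_left] at this
    exact this
  set μ := P.restrict (gridCylinder X h n a) with hμ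
  have hm := hX ((n + 1 : ℕ) * h)
  have hgm : Measurable g := measurable_from_top
  have hint : Integrable g (μ.map (X ((n + 1 : ℕ) * h))) := by
    refine Integrable.of_bound hgm.aestronglyMeasurable M (Eventually.of_forall fun y => ?_)
    exact hg y
  rw [← integral_map hm.aemeasurable hgm.aestronglyMeasurable, integral_countable hint]
  unfold semi
  rw [← tsum_mul_left]
  refine tsum_congr fun y => ?_
  have h1 : (μ.map (X ((n + 1 : ℕ) * h))).real {y}
      = P.real (gridCylinder X h (n + 1) fun i => if i ≤ n then a i else y) := by
    rw [map_measureReal_apply hm (measurableSet_singleton y), hμ, measureReal_restrict_apply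
      (hm (measurableSet_singleton y))]
    congr 1
    ext ω
    simp only [gridCylinder, Set.mem_inter_iff, Set.mem_preimage, Set.mem_singleton_iff,
      Set.mem_ofPred_eq]
    constructor
    · rintro ⟨e1, e2⟩ i hi
      split_ifs with hin
      · exact e2 i hin
      · obtain rfl : i = n + 1 := by omega
        exact e1
    · intro e
      refine ⟨by simpa using e (n + 1) le_rfl, fun i hi => ?_⟩
      simpa [hi] using e i (by omega)
  rw [h1, hgrid, hgrid, Finset.prod_range_succ]
  have h2 : ∏ i ∈ Finset.range n, p h (if i ≤ n then a i else y) (if i + 1 ≤ n then a (i + 1) else y)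
      = ∏ i ∈ Finset.range n, p h (a i) (a (i + 1)) := by
    refine Finset.prod_congr rfl fun i hi => ?_
    have := Finset.mem_range.1 hi
    rw [if_pos (by omega), if_pos (by omega)]
  simp only [h2, smul_eq_mul]
  simp
  ring_nf

omit [IsProbabilityMeasure P] in
-- Indexing by `Fin (n + 1) → ℕ` keeps the partition into cylinders countable.
theorem integral_eq_tsum_gridCylinder (hX : ∀ t, Measurable (X t)) (h : ℝ≥0) (n : ℕ)
    {F : Ω → ℝ} (hF : Integrable F P) :
    ∫ ω, F ω ∂P = ∑' a : Fin (n + 1) → ℕ,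
      ∫ ω in gridCylinder X h n (fun i => a (Fin.ofNat (n + 1) i)), F ω ∂P := by
  have hU : (⋃ a : Fin (n + 1) → ℕ, gridCylinder X h n fun i => a (Fin.ofNat (n + 1) i))
      = Set.univ := by
    refine Set.eq_univ_of_forall fun ω => Set.mem_iUnion.2 ⟨fun i => X (i * h) ω, fun i hi => ?_⟩
    simp [Nat.mod_eq_of_lt (Nat.lt_succ_of_le hi)]
  rw [← setIntegral_univ, ← hU]
  refine integral_iUnion (fun a => measurableSet_gridCylinder hX h n _) ?_ hF.integrableOn
  intro a b hab
  refine Set.disjoint_left.2 fun ω ha hb => hab (funext fun i => ?_)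
  have e1 := ha i (Nat.le_of_lt_succ i.2)
  have e2 := hb i (Nat.le_of_lt_succ i.2)
  simp only [Fin.ofNat_eq_cast, Fin.cast_val_eq_self] at e1 e2
  rw [← e1, e2]

theorem abs_prod_le_one {ι : Type*} (s : Finset ι) {f : ι → ℝ} (hf : ∀ i, |f i| ≤ 1) :
    |∏ i ∈ s, f i| ≤ 1 := by
  rw [Finset.abs_prod]
  exact Finset.prod_le_one (fun i _ => abs_nonneg _) fun i _ => hf i

/-- The finite-dimensional distributions determine the starting point. -/
theorem ae_zero_eq {p : ℝ≥0 → ℕ → ℕ → ℝ} {x : ℕ} (hX : ∀ t, Measurable (X t))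
    (hfdd : ∀ (n : ℕ) (t : ℕ → ℝ≥0) (a : ℕ → ℕ), t 0 = 0 → Monotone t →
      P.real {ω | ∀ i ≤ n, X (t i) ω = a i} = (if a 0 = x then 1 else 0) *
        ∏ i ∈ Finset.range n, p (t (i + 1) - t i) (a i) (a (i + 1))) :
    ∀ᵐ ω ∂P, X 0 ω = x := by
  have h1 := hfdd 0 (fun _ => 0) (fun _ => x) rfl monotone_const
  have h2 : MeasurableSet {ω | X 0 ω = x} := hX 0 (measurableSet_singleton x)
  have h3 : P.real {ω | X 0 ω = x} = 1 := by simpa using h1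
  rw [ae_iff_measure_eq h2.nullMeasurableSet, measure_univ]
  rwa [measureReal_def, ENNReal.toReal_eq_one_iff] at h3

/-- The expectation of a multiplicative functional of the path at the times `h, 2h, ..., n h`. -/
theorem integral_prod_eq_iterate_weightedSemi {lam nu : ℕ → ℝ} {p : ℝ≥0 → ℕ → ℕ → ℝ} {x : ℕ}
    (hp : IsTransitionFunction lam nu p) (hX : ∀ t, Measurable (X t))
    (hfdd : ∀ (n : ℕ) (t : ℕ → ℝ≥0) (a : ℕ → ℕ), t 0 = 0 → Monotone t →
      P.real {ω | ∀ i ≤ n, X (t i) ω = a i} = (if a 0 = x then 1 else 0) *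
        ∏ i ∈ Finset.range n, p (t (i + 1) - t i) (a i) (a (i + 1)))
    {φ : ℕ → ℝ} (hφ : ∀ y, |φ y| ≤ 1) (h : ℝ≥0) (n : ℕ) {f : ℕ → ℝ} {M : ℝ}
    (hf : ∀ y, |f y| ≤ M) :
    ∫ ω, (∏ i ∈ Finset.range n, φ (X ((i + 1 : ℕ) * h) ω)) * f (X (n * h) ω) ∂P =
      (weightedSemi p h φ)^[n] f x := by
  induction n generalizing f with
  | zero =>
    have : ∫ ω, f (X 0 ω) ∂P = ∫ ω, f x ∂P :=
      integral_congr_ae ((ae_zero_eq hX hfdd).mono fun ω hω => by simp only [hω])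
    simpa using this
  | succ n ih =>
    have hφf := abs_mul_le_of_abs_le_one hφ hf
    -- The latest time is integrated out first: conditioning at `n * h` replaces `φ * f` at the next
    -- time by `weightedSemi p h φ f` at the current one.
    rw [Function.iterate_succ_apply, ← ih (hp.abs_weightedSemi_le hφ hf h)]
    have hmeas : ∀ (g : ℕ → ℝ) (m : ℕ), Measurable fun ω =>
        (∏ i ∈ Finset.range n, φ (X ((i + 1 : ℕ) * h) ω)) * g (X (m * h) ω) := fun g m =>
      (Finset.measurable_prod _ fun i _ =>
        (measurable_from_top (f := φ)).comp (hX _)).mul ((measurable_from_top (f := g)).comp (hX _))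
    have hint : ∀ (g : ℕ → ℝ) (m : ℕ), (∀ y, |g y| ≤ M) → Integrable (fun ω =>
        (∏ i ∈ Finset.range n, φ (X ((i + 1 : ℕ) * h) ω)) * g (X (m * h) ω)) P := fun g m hg => by
      refine Integrable.of_bound (hmeas g m).aestronglyMeasurable M
        (Eventually.of_forall fun ω => ?_)
      rw [Real.norm_eq_abs, abs_mul]
      exact (mul_le_mul (abs_prod_le_one _ fun i => hφ _) (hg _) (abs_nonneg _)
        zero_le_one).trans (one_mul M).le
    calc _ = ∫ ω, (∏ i ∈ Finset.range n, φ (X ((i + 1 : ℕ) * h) ω)) *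
          (φ (X ((n + 1 : ℕ) * h) ω) * f (X ((n + 1 : ℕ) * h) ω)) ∂P := by
          simp only [Finset.prod_range_succ, mul_assoc]
      _ = _ := by
        rw [integral_eq_tsum_gridCylinder hX h n (hint (fun y => φ y * f y) (n + 1) hφf),
          integral_eq_tsum_gridCylinder hX h n (hint _ n (hp.abs_weightedSemi_le hφ hf h))]
        refine tsum_congr fun a => ?_
        set b : ℕ → ℕ := fun i => a (Fin.ofNat (n + 1) i)
        have hms := measurableSet_gridCylinder hX h n b
        have e1 : ∀ ω ∈ gridCylinder X h n b, ∏ i ∈ Finset.range n, φ (X ((i + 1 : ℕ) * h) ω)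
            = ∏ i ∈ Finset.range n, φ (b (i + 1)) := fun ω hω =>
          Finset.prod_congr rfl fun i hi => by
            rw [hω (i + 1) (Finset.mem_range.1 hi)]
        rw [setIntegral_congr_fun hms (g := fun ω => (∏ i ∈ Finset.range n, φ (b (i + 1))) *
            (φ (X ((n + 1 : ℕ) * h) ω) * f (X ((n + 1 : ℕ) * h) ω)))
            (fun ω hω => by simp only [e1 ω hω]),
          setIntegral_congr_fun hms (f := fun ω => (∏ i ∈ Finset.range n,
            φ (X ((i + 1 : ℕ) * h) ω)) * weightedSemi p h φ f (X (n * h) ω))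
            (g := fun ω => (∏ i ∈ Finset.range n, φ (b (i + 1))) * weightedSemi p h φ f (b n))
            (fun ω hω => by simp only [e1 ω hω, hω n le_rfl]),
          integral_const_mul (∏ i ∈ Finset.range n, φ (b (i + 1)))
            (fun ω => φ (X ((n + 1 : ℕ) * h) ω) * f (X ((n + 1 : ℕ) * h) ω)),
          setIntegral_gridCylinder hX hfdd (g := fun y => φ y * f y) hφf h n b, setIntegral_const,
          smul_eq_mul]
        simp only [weightedSemi]
        ring

end fdd

/-! ### Convergence along refined grids -/

/-- The mesh `t / (n + 1)` of the regular grid on `[0, t]`. -/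
noncomputable def mesh (t : ℝ≥0) (n : ℕ) : ℝ≥0 := t / (n + 1 : ℕ)

theorem succ_mul_mesh (t : ℝ≥0) (n : ℕ) : ((n + 1 : ℕ) : ℝ≥0) * mesh t n = t :=
  mul_div_cancel₀ t (by positivity)

theorem tendsto_mesh (t : ℝ≥0) : Tendsto (mesh t) atTop (𝓝 0) := by
  rw [← NNReal.tendsto_coe]
  have := (tendsto_one_div_add_atTop_nhds_zero_nat (𝕜 := ℝ)).const_mul (t : ℝ)
  simpa [mesh, div_eq_mul_inv] using this

theorem tendsto_ceil_div_mul_mesh {t : ℝ≥0} (ht : 0 < t) (s : ℝ≥0) :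
    Tendsto (fun n => (⌈s / mesh t n⌉₊ : ℝ≥0) * mesh t n) atTop (𝓝[≥] s) := by
  have hpos : ∀ n, 0 < mesh t n := fun n => div_pos ht (by positivity)
  have lower : ∀ n, s ≤ (⌈s / mesh t n⌉₊ : ℝ≥0) * mesh t n := fun n => by
    rw [← div_le_iff₀ (hpos n)]
    exact Nat.le_ceil _
  have upper : ∀ n, (⌈s / mesh t n⌉₊ : ℝ≥0) * mesh t n ≤ s + mesh t n := fun n => by
    have := (Nat.ceil_lt_add_one (zero_le (a := s / mesh t n))).le
    calc _ ≤ (s / mesh t n + 1) * mesh t n := by gcongr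
      _ = s + mesh t n := by rw [add_mul, div_mul_cancel₀ _ (hpos n).ne', one_mul]
  refine tendsto_nhdsWithin_iff.2 ⟨?_, Eventually.of_forall lower⟩
  refine tendsto_of_tendsto_of_tendsto_of_le_of_le tendsto_const_nhds ?_ lower upper
  simpa using tendsto_const_nhds.add (tendsto_mesh t)

/-- Rounding up approaches `s` from the right, where a right-continuous path in a discrete space is
locally constant. -/
theorem eventually_eq_grid {y : ℝ≥0 → ℕ} {s : ℝ≥0} (hy : ContinuousWithinAt y (Set.Ici s) s)
    {t : ℝ≥0} (ht : 0 < t) :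
    ∀ᶠ n in atTop, y ((⌈s / mesh t n⌉₊ : ℝ≥0) * mesh t n) = y s := by
  have h1 : ∀ᶠ r in 𝓝[≥] s, y r = y s := by
    have : Tendsto y (𝓝[≥] s) (pure (y s)) := by simpa [ContinuousWithinAt] using hy
    exact tendsto_pure.1 this
  exact (tendsto_ceil_div_mul_mesh ht s).eventually h1

/-- Riemann sums at right end points converge along a right-continuous integer-valued path. -/
theorem tendsto_sum_grid {y : ℝ≥0 → ℕ} (hy : ∀ s, ContinuousWithinAt y (Set.Ici s) s)
    {g : ℕ → ℝ} {M : ℝ} (hg : ∀ z, |g z| ≤ M) (t : ℝ≥0) :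
    Tendsto (fun n => ∑ i ∈ Finset.range (n + 1), g (y ((i + 1 : ℕ) * mesh t n)) * mesh t n) atTop
      (𝓝 (∫ s in (0 : ℝ)..t, g (y s.toNNReal))) := by
  rcases eq_or_lt_of_le (zero_le (a := t)) with rfl | ht
  · simp [mesh]
  have hpos : ∀ n, 0 < mesh t n := fun n => div_pos ht (by positivity)
  -- On each cell `(i h, (i + 1) h]` this step function takes the value at the right end point, so
  -- the sum is exactly its integral.
  set F : ℕ → ℝ → ℝ := fun n s => g (y ((⌈s.toNNReal / mesh t n⌉₊ : ℝ≥0) * mesh t n)) with hF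
  have hsum : ∀ n, ∑ i ∈ Finset.range (n + 1), g (y ((i + 1 : ℕ) * mesh t n)) * mesh t n
      = ∫ s in (0 : ℝ)..t, F n s := by
    intro n
    have hn : (0 : ℝ) < mesh t n := hpos n
    have hle : ∀ i : ℕ, (i : ℝ) * mesh t n ≤ ((i + 1 : ℕ) : ℝ) * mesh t n := fun i => by
      push_cast; nlinarith
    have hEq : ∀ i : ℕ, Set.EqOn (fun _ => g (y ((i + 1 : ℕ) * mesh t n))) (F n)
        (Set.uIoc ((i : ℝ) * mesh t n) (((i + 1 : ℕ) : ℝ) * mesh t n)) := fun i s hs => by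
      rw [Set.uIoc_of_le (hle i)] at hs
      have hs0 : 0 ≤ s := le_trans (by positivity) hs.1.le
      have : ⌈s.toNNReal / mesh t n⌉₊ = i + 1 := by
        rw [Nat.ceil_eq_iff (by omega), Nat.add_sub_cancel, lt_div_iff₀ (hpos n),
          div_le_iff₀ (hpos n), ← NNReal.coe_lt_coe, ← NNReal.coe_le_coe]
        push_cast
        rw [Real.coe_toNNReal _ hs0]
        exact ⟨hs.1, by simpa using hs.2⟩
      simp only [hF, this]
    have h1 := intervalIntegral.sum_integral_adjacent_intervals (f := F n) (μ := volume)
      (a := fun i : ℕ => (i : ℝ) * mesh t n) (n := n + 1)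
      fun i _ => IntervalIntegrable.congr (hEq i) intervalIntegrable_const
    have h2 : ((n + 1 : ℕ) : ℝ) * mesh t n = t := by
      exact_mod_cast congrArg NNReal.toReal (succ_mul_mesh t n)
    rw [h2, Nat.cast_zero, zero_mul] at h1
    rw [← h1]
    refine Finset.sum_congr rfl fun i _ => ?_
    rw [← intervalIntegral.integral_congr_ae (ae_of_all _ fun s hs => hEq i hs),
      intervalIntegral.integral_const, smul_eq_mul]
    push_cast
    ring
  simp only [hsum]
  refine intervalIntegral.tendsto_integral_filter_of_dominated_convergence (fun _ => M) ?_ ?_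
    intervalIntegrable_const ?_
  · refine Eventually.of_forall fun n => Measurable.aestronglyMeasurable ?_
    have : Measurable fun s : ℝ => ⌈s.toNNReal / mesh t n⌉₊ :=
      Nat.measurable_ceil.comp (measurable_real_toNNReal.div_const _)
    exact (measurable_from_top (f := fun k : ℕ => g (y ((k : ℝ≥0) * mesh t n)))).comp this
  · exact Eventually.of_forall fun n => ae_of_all _ fun s _ => hg _
  · refine ae_of_all _ fun s _ => tendsto_const_nhds.congr' ?_
    filter_upwards [eventually_eq_grid (hy s.toNNReal) ht] with n hn
    simp only [hF, hn]

/-- The products of `1_{≥ 1}` along the grids converge to the indicator of not having hit `0`. -/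
theorem tendsto_prod_posInd {Ω : Type*} {X : ℝ≥0 → Ω → ℕ} {ω : Ω}
    (hy : ∀ s, ContinuousWithinAt (fun s => X s ω) (Set.Ici s) s) (h0 : X 0 ω ≠ 0) (t : ℝ≥0) :
    Tendsto (fun n => ∏ i ∈ Finset.range (n + 1), posInd (X ((i + 1 : ℕ) * mesh t n) ω)) atTop
      (𝓝 ({ω | (t : ℝ≥0∞) < hitZero X ω}.indicator (fun _ => (1 : ℝ)) ω)) := by
  by_cases ht : (t : ℝ≥0∞) < hitZero X ω
  · have hne : ∀ s, s ≤ t → X s ω ≠ 0 := fun s hs hs0 => by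
      rcases eq_or_lt_of_le (zero_le (a := s)) with rfl | hpos
      · exact h0 hs0
      · have : hitZero X ω ≤ (s : ℝ≥0∞) := iInf₂_le s ⟨hpos, hs0⟩
        exact absurd (ht.trans_le this) (not_lt.2 (by exact_mod_cast hs))
    rw [Set.indicator_of_mem (by exact ht)]
    refine tendsto_const_nhds.congr fun n => (Finset.prod_eq_one fun i hi => ?_).symm
    have hle : ((i + 1 : ℕ) : ℝ≥0) * mesh t n ≤ t := by
      calc _ ≤ ((n + 1 : ℕ) : ℝ≥0) * mesh t n := by
            gcongr
            exact Nat.lt_succ_iff.1 (Finset.mem_range.1 hi)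
        _ = t := succ_mul_mesh t n
    rw [posInd, if_neg (hne _ hle)]
  · rw [Set.indicator_of_notMem (by exact ht)]
    -- By right-continuity the path keeps the value `X t ω` for a while after `t`. If it had no zero
    -- in `(0, t]`, the hitting time would therefore exceed `t` strictly.
    obtain ⟨s, hs0, hst, hs⟩ : ∃ s, 0 < s ∧ s ≤ t ∧ X s ω = 0 := by
      by_contra! hcon
      have hne : X t ω ≠ 0 := by
        rcases eq_or_lt_of_le (zero_le (a := t)) with rfl | hpos
        · exact h0
        · exact hcon t hpos le_rfl
      have h1 : ∀ᶠ r in 𝓝[≥] t, X r ω = X t ω := by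
        have : Tendsto (fun s => X s ω) (𝓝[≥] t) (pure (X t ω)) := by
          simpa [ContinuousWithinAt] using hy t
        exact tendsto_pure.1 this
      obtain ⟨u, hu, hsub⟩ := mem_nhdsGE_iff_exists_Ico_subset.1 h1
      refine ht (lt_of_lt_of_le (ENNReal.coe_lt_coe.2 hu) (le_iInf₂ fun s hs => ?_))
      rw [ENNReal.coe_le_coe]
      by_contra! hlt
      rcases le_total s t with hst | hst
      · exact hcon s hs.1 hst hs.2
      · exact hne ((hsub ⟨hst, hlt⟩).symm.trans hs.2)
    have ht0 : 0 < t := hs0.trans_le hst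
    have hpos : ∀ n, 0 < mesh t n := fun n => div_pos ht0 (by positivity)
    refine tendsto_const_nhds.congr' ?_
    filter_upwards [eventually_eq_grid (hy s) ht0] with n hn
    rw [hs] at hn
    have hk0 : 0 < ⌈s / mesh t n⌉₊ := Nat.ceil_pos.2 (div_pos hs0 (hpos n))
    have hk1 : ⌈s / mesh t n⌉₊ ≤ n + 1 := by
      rw [Nat.ceil_le, div_le_iff₀ (hpos n), succ_mul_mesh]
      exact hst
    -- The factor of index `i` is taken at time `(i + 1) h`, hence the shift by one.
    refine (Finset.prod_eq_zero (i := ⌈s / mesh t n⌉₊ - 1) (Finset.mem_range.2 (by omega)) ?_).symm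
    rw [Nat.sub_add_cancel hk0, hn]
    simp [posInd]

/-! ### Limits of the grid expectations -/

section limits

variable {Ω : Type*} [MeasurableSpace Ω] {P : Measure Ω} [IsProbabilityMeasure P]
  {X : ℝ≥0 → Ω → ℕ} {lam nu : ℕ → ℝ} {x : ℕ}

theorem IsProcess.tendsto_integral_prod_posInd (hX : IsProcess P lam nu x X) (hx : x ≠ 0)
    (t : ℝ≥0) :
    Tendsto (fun n => ∫ ω, (∏ i ∈ Finset.range (n + 1), posInd (X ((i + 1 : ℕ) * mesh t n) ω)) * 1
      ∂P) atTop (𝓝 (P.real {ω | (t : ℝ≥0∞) < hitZero X ω})) := by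
  simp only [mul_one]
  set S := {ω | (t : ℝ≥0∞) < hitZero X ω}
  have hmeas : ∀ n, Measurable fun ω =>
      ∏ i ∈ Finset.range (n + 1), posInd (X ((i + 1 : ℕ) * mesh t n) ω) := fun n =>
    Finset.measurable_prod _ fun i _ =>
      (measurable_from_top (f := posInd)).comp (hX.measurable _)
  have hlim : ∀ᵐ ω ∂P, Tendsto (fun n => ∏ i ∈ Finset.range (n + 1),
      posInd (X ((i + 1 : ℕ) * mesh t n) ω)) atTop (𝓝 (S.indicator (fun _ => (1 : ℝ)) ω)) := by
    obtain ⟨p, -, hfdd⟩ := hX.markov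
    filter_upwards [hX.cadlag, ae_zero_eq hX.measurable hfdd] with ω h1 h2
    exact tendsto_prod_posInd (fun s => (h1 s).1) (by rwa [h2]) t
  -- The hitting event involves uncountably many times; its null-measurability comes from the a.e.
  -- limit of measurable grid products.
  have hS : NullMeasurableSet S P := (aemeasurable_indicator_const_iff (1 : ℝ)).1
    (aemeasurable_of_tendsto_metrizable_ae atTop (fun n => (hmeas n).aemeasurable) hlim)
  have := tendsto_integral_of_dominated_convergence (fun _ => (1 : ℝ))
    (fun n => (hmeas n).aestronglyMeasurable) (integrable_const _)
    (fun n => ae_of_all _ fun ω => abs_prod_le_one _ fun i => abs_posInd_le _) hlim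
  rwa [integral_indicator₀ hS, setIntegral_const, smul_eq_mul, mul_one] at this

theorem killRate_eq (c s : ℝ) (y : ℕ) :
    killRate c s y = c + s * Set.indicator {0} (fun _ : ℕ => (1 : ℝ)) y := by
  unfold killRate
  split_ifs with h <;> simp [h]

theorem IsProcess.tendsto_integral_prod_killRate (hX : IsProcess P lam nu x X) {c s : ℝ}
    (hc : 0 ≤ c) (hs : 0 ≤ s) {v : ℕ → ℝ} (hv : ∀ y, |v y| ≤ 1) (t : ℝ≥0) :
    Tendsto (fun n => ∫ ω, (∏ i ∈ Finset.range (n + 1),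
      Real.exp (-(killRate c s (X ((i + 1 : ℕ) * mesh t n) ω) * mesh t n))) *
        v (X ((n + 1 : ℕ) * mesh t n) ω) ∂P) atTop
      (𝓝 (∫ ω, Real.exp (-(c * t)) * (v (X t ω) * Real.exp (-s *
        ∫ r in (0 : ℝ)..t, Set.indicator {0} (fun _ : ℕ => (1 : ℝ)) (X r.toNNReal ω))) ∂P)) := by
  simp only [succ_mul_mesh]
  refine tendsto_integral_of_dominated_convergence (fun _ => (1 : ℝ)) (fun n => ?_)
    (integrable_const _) (fun n => ae_of_all _ fun ω => ?_) ?_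
  · refine Measurable.aestronglyMeasurable (Measurable.mul ?_
      ((measurable_from_top (f := v)).comp (hX.measurable _)))
    exact Finset.measurable_prod _ fun i _ => (measurable_from_top
      (f := fun y => Real.exp (-(killRate c s y * mesh t n)))).comp (hX.measurable _)
  · refine (norm_mul_le _ _).trans (mul_le_one₀ ?_ (norm_nonneg _) (hv _))
    exact abs_prod_le_one _ fun i => abs_exp_neg_killRate_le hc hs (mesh t n).2 _
  · filter_upwards [hX.cadlag] with ω h1
    have hg : ∀ z : ℕ, |Set.indicator {0} (fun _ : ℕ => (1 : ℝ)) z| ≤ 1 := fun z => by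
      by_cases hz : z = 0 <;> simp [hz]
    have h2 := tendsto_sum_grid (fun r => (h1 r).1) hg t
    have h3 := ((Real.continuous_exp.tendsto _).comp (h2.const_mul (-s))).const_mul
      (Real.exp (-(c * t)))
    have h4 := h3.mul_const (v (X t ω))
    refine (h4.congr fun n => ?_).trans_eq ?_
    · rw [← Real.exp_sum, Function.comp_apply, ← Real.exp_add]
      congr 2
      have h5 : ((n + 1 : ℕ) : ℝ) * mesh t n = t := by
        exact_mod_cast congrArg NNReal.toReal (succ_mul_mesh t n)
      simp only [killRate_eq, Finset.sum_neg_distrib, add_mul, Finset.sum_add_distrib,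
        Finset.sum_const, Finset.card_range, nsmul_eq_mul, mul_assoc, ← Finset.mul_sum]
      rw [← h5]
      ring
    · congr 1
      ring

end limits

/-! ### The modified queue and the representation formula -/

theorem weight_facts {lam nu : ℝ} (hlam : 0 < lam) (hnu : lam < nu) :
    (∀ y, 1 ≤ weight lam nu y) ∧
    (∀ y, Real.sqrt (lam * nu) * weight lam nu y = lam * weight lam nu (y + 1)) ∧
    (∀ y, Real.sqrt (lam * nu) * weight lam nu (y + 1) = nu * weight lam nu y) := by
  have hnu0 : 0 < nu := hlam.trans hnu
  have hr : 1 ≤ nu / lam := (one_le_div hlam).2 hnu.le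
  have hw : ∀ y, weight lam nu (y + 1) = weight lam nu y * Real.sqrt (nu / lam) := fun y => by
    unfold weight
    rw [Real.sqrt_eq_rpow, ← Real.rpow_add (by positivity)]
    congr 1
    push_cast
    ring
  have e1 : Real.sqrt (lam * nu) = lam * Real.sqrt (nu / lam) := by
    rw [← Real.sqrt_sq hlam.le, ← Real.sqrt_mul (by positivity), Real.sqrt_sq hlam.le]
    congr 1
    field_simp
  have e2 : Real.sqrt (lam * nu) * Real.sqrt (nu / lam) = nu := by
    rw [e1, mul_assoc, Real.mul_self_sqrt (by positivity)]
    field_simp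
  refine ⟨fun y => Real.one_le_rpow hr (by positivity), fun y => ?_, fun y => ?_⟩
  · rw [hw, e1]; ring
  · rw [hw]; linear_combination weight lam nu y * e2

theorem modBirth_mm1 {lam nu : ℝ} (hlam : 0 < lam) (hnu : lam < nu) :
    modBirth (weight lam nu) (mm1Birth lam) = mm1Birth (Real.sqrt (lam * nu)) := by
  obtain ⟨h0, h1, -⟩ := weight_facts hlam hnu
  funext y
  have : weight lam nu y ≠ 0 := (zero_lt_one.trans_le (h0 y)).ne'
  simp only [modBirth, mm1Birth]
  field_simp
  linear_combination -h1 y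

theorem modDeath_mm1 {lam nu : ℝ} (hlam : 0 < lam) (hnu : lam < nu) :
    modDeath (weight lam nu) (mm1Death nu) = mm1Death (Real.sqrt (lam * nu)) := by
  obtain ⟨h0, -, h2⟩ := weight_facts hlam hnu
  funext y
  rcases y with _ | y
  · simp [modDeath, mm1Death]
  · have : weight lam nu (y + 1) ≠ 0 := (zero_lt_one.trans_le (h0 (y + 1))).ne'
    simp only [modDeath, mm1Death, Nat.add_sub_cancel, Nat.add_one_ne_zero, if_false]
    rw [div_mul_eq_mul_div, div_eq_iff this, mul_comm]
    exact (h2 y).symm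

/-- The Feynman-Kac representation of the tail of the hitting time of the origin. -/
theorem real_lt_hitZero_mm1_eq {lam nu : ℝ} (hlam : 0 < lam) (hnu : lam < nu) {x : ℕ}
    {Ω : Type*} [MeasurableSpace Ω] {P : Measure Ω} [IsProbabilityMeasure P]
    {X : ℝ≥0 → Ω → ℕ} (hX : IsProcess P (mm1Birth lam) (mm1Death nu) (x + 1) X)
    {Ω' : Type*} [MeasurableSpace Ω'] {P' : Measure Ω'} [IsProbabilityMeasure P']
    {Y : ℝ≥0 → Ω' → ℕ}
    (hY : IsProcess P' (mm1Birth (Real.sqrt (lam * nu))) (mm1Death (Real.sqrt (lam * nu))) x Y)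
    (t : ℝ≥0) :
    P.real {ω | (t : ℝ≥0∞) < hitZero X ω} =
      weight lam nu x * Real.exp (-(t : ℝ) * (Real.sqrt lam - Real.sqrt nu) ^ 2) *
        ∫ ω, (weight lam nu (Y t ω))⁻¹ * Real.exp (-Real.sqrt (lam * nu) *
            ∫ s in (0 : ℝ)..(t : ℝ),
              Set.indicator {0} (fun _ : ℕ => (1 : ℝ)) (Y s.toNNReal ω)) ∂P' := by
  obtain ⟨hw, hw1, hw2⟩ := weight_facts hlam hnu
  have hnu0 : 0 < nu := hlam.trans hnu
  set s := Real.sqrt (lam * nu) with hs_def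
  have hs : 0 ≤ s := Real.sqrt_nonneg _
  set c := (Real.sqrt lam - Real.sqrt nu) ^ 2 with hc_def
  have hc0 : 0 ≤ c := sq_nonneg _
  have hc : lam + nu = c + 2 * s := by
    rw [hc_def, hs_def, Real.sqrt_mul hlam.le, sub_sq, Real.sq_sqrt hlam.le, Real.sq_sqrt hnu0.le]
    ring
  have hwpos : ∀ y, 0 < weight lam nu y := fun y => zero_lt_one.trans_le (hw y)
  set v : ℕ → ℝ := fun y => (weight lam nu y)⁻¹ with hv_def
  have hv0 : ∀ y, 0 ≤ v y := fun y => (inv_pos.2 (hwpos y)).le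
  have hv1 : ∀ y, v y ≤ 1 := fun y => inv_le_one_of_one_le₀ (hw y)
  have hvabs : ∀ y, |v y| ≤ 1 := fun y => by rw [abs_of_nonneg (hv0 y)]; exact hv1 y
  have h1 : ∀ y, lam * v y = s * v (y + 1) := fun y => by
    have := (hwpos y).ne'
    have := (hwpos (y + 1)).ne'
    simp only [hv_def]
    field_simp
    linear_combination -hw1 y
  have h2 : ∀ y, nu * v (y + 1) = s * v y := fun y => by
    have := (hwpos y).ne'
    have := (hwpos (y + 1)).ne'
    simp only [hv_def]
    field_simp
    linear_combination -hw2 y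
  obtain ⟨p, hp, hfdd⟩ := hX.markov
  obtain ⟨p', hp', hfdd'⟩ := hY.markov
  have limX := hX.tendsto_integral_prod_posInd (Nat.succ_ne_zero x) t
  have limY := hY.tendsto_integral_prod_killRate hc0 hs hvabs t
  simp only [integral_prod_eq_iterate_weightedSemi hp hX.measurable hfdd abs_posInd_le _ _
    (f := fun _ => 1) (M := 1) (fun _ => by simp)] at limX
  have e : ∀ n : ℕ, ∫ ω, (∏ i ∈ Finset.range (n + 1),
      Real.exp (-(killRate c s (Y ((i + 1 : ℕ) * mesh t n) ω) * mesh t n))) *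
        v (Y ((n + 1 : ℕ) * mesh t n) ω) ∂P' = (weightedSemi p' (mesh t n)
          fun y => Real.exp (-(killRate c s y * mesh t n)))^[n + 1] v x := fun n =>
    integral_prod_eq_iterate_weightedSemi hp' hY.measurable hfdd'
      (abs_exp_neg_killRate_le hc0 hs (mesh t n).2) _ _ hvabs
  simp only [e] at limY
  set K := (2 * (lam + nu)) ^ 2 + (2 * (s + s)) ^ 2 + 2 * (s + s) * (c + s) + (c + s) ^ 2
  have limK : Tendsto (fun n => (t : ℝ) * K * (mesh t n : ℝ)) atTop (𝓝 0) := by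
    have : Tendsto (fun n => (mesh t n : ℝ)) atTop (𝓝 0) :=
      (NNReal.continuous_coe.tendsto' 0 0 (by simp)).comp (tendsto_mesh t)
    simpa using this.const_mul ((t : ℝ) * K)
  -- There are `n + 1` steps with error `K h²` each, and `(n + 1) h = t`, so the total is `t K h`.
  have limD := squeeze_zero_norm (f := fun n =>
    v x * (weightedSemi p (mesh t n) posInd)^[n + 1] (fun _ => 1) (x + 1) -
      (weightedSemi p' (mesh t n) fun y => Real.exp (-(killRate c s y * mesh t n)))^[n + 1] v x)
    (fun n => (abs_iterate_weightedSemi_intertwine_le hlam.le hnu0.le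
    hc0 hs hv0 hv1 h1 h2 hc hp hp' (mesh t n) (n + 1) x).trans (le_of_eq (by
      have h5 : ((n + 1 : ℕ) : ℝ) * mesh t n = t := by
        exact_mod_cast congrArg NNReal.toReal (succ_mul_mesh t n)
      change _ = (t : ℝ) * K * (mesh t n : ℝ)
      rw [← h5]
      ring))) limK
  have key := tendsto_nhds_unique limD ((limX.const_mul (v x)).sub limY)
  rw [integral_const_mul] at key
  have hvx : weight lam nu x * v x = 1 := mul_inv_cancel₀ (hwpos x).ne'
  rw [show -(t : ℝ) * c = -(c * t) by ring]
  linear_combination (-P.real {ω | (t : ℝ≥0∞) < hitZero X ω}) * hvx - weight lam nu x * key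

theorem integral_inv_weight_mul_exp_le_one {lam nu : ℝ} (hlam : 0 < lam) (hnu : lam < nu)
    {Ω : Type*} [MeasurableSpace Ω] (P : Measure Ω) [IsProbabilityMeasure P]
    (Y : ℝ≥0 → Ω → ℕ) (t : ℝ≥0) :
    ∫ ω, (weight lam nu (Y t ω))⁻¹ * Real.exp (-Real.sqrt (lam * nu) *
      ∫ s in (0 : ℝ)..(t : ℝ),
        Set.indicator {0} (fun _ : ℕ => (1 : ℝ)) (Y s.toNNReal ω)) ∂P ≤ 1 := by
  have hw := (weight_facts hlam hnu).1
  suffices h : ∀ ω, ‖(weight lam nu (Y t ω))⁻¹ * Real.exp (-Real.sqrt (lam * nu) *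
      ∫ s in (0 : ℝ)..(t : ℝ),
        Set.indicator {0} (fun _ : ℕ => (1 : ℝ)) (Y s.toNNReal ω))‖ ≤ 1 by
    -- A pointwise bound on the norm needs no measurability of `Y`.
    have := norm_integral_le_of_norm_le_const (ae_of_all P h)
    rw [probReal_univ, mul_one] at this
    exact (le_abs_self _).trans this
  intro ω
  have h0 : 0 ≤ ∫ r in (0 : ℝ)..t, Set.indicator {0} (fun _ : ℕ => (1 : ℝ)) (Y r.toNNReal ω) :=
    intervalIntegral.integral_nonneg t.2 fun r _ =>
      Set.indicator_nonneg (fun _ _ => zero_le_one) _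
  refine (norm_mul_le _ _).trans (mul_le_one₀ ?_ (norm_nonneg _) ?_)
  · rw [Real.norm_eq_abs, abs_of_pos (inv_pos.2 (zero_lt_one.trans_le (hw _)))]
    exact inv_le_one_of_one_le₀ (hw _)
  · rw [Real.norm_eq_abs, abs_of_pos (Real.exp_pos _), Real.exp_le_one_iff, neg_mul]
    exact neg_nonpos.2 (mul_nonneg (Real.sqrt_nonneg _) h0)

end BirthDeath

theorem mainTheorem7 (lam nu : ℝ) (hlam : 0 < lam) (hnu : lam < nu) (x : ℕ)
    {Ω : Type*} [MeasurableSpace Ω] (P : Measure Ω) [IsProbabilityMeasure P]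
    (X : ℝ≥0 → Ω → ℕ)
    (hX : BirthDeath.IsProcess P (BirthDeath.mm1Birth lam) (BirthDeath.mm1Death nu) (x + 1) X)
    {Ω' : Type*} [MeasurableSpace Ω'] (P' : Measure Ω') [IsProbabilityMeasure P']
    (Y : ℝ≥0 → Ω' → ℕ)
    (hY : BirthDeath.IsProcess P'
      (BirthDeath.modBirth (BirthDeath.weight lam nu) (BirthDeath.mm1Birth lam))
      (BirthDeath.modDeath (BirthDeath.weight lam nu) (BirthDeath.mm1Death nu)) x Y)
    (t : ℝ≥0) :
    (∀ y : ℕ, 1 ≤ BirthDeath.weight lam nu y) ∧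
    P.real {ω | (t : ℝ≥0∞) < BirthDeath.hitZero X ω} =
      BirthDeath.weight lam nu x *
        Real.exp (-(t : ℝ) * (Real.sqrt lam - Real.sqrt nu) ^ 2) *
        ∫ ω, (BirthDeath.weight lam nu (Y t ω))⁻¹ *
          Real.exp (-Real.sqrt (lam * nu) *
            ∫ s in (0 : ℝ)..(t : ℝ),
              Set.indicator {0} (fun _ : ℕ => (1 : ℝ)) (Y s.toNNReal ω)) ∂P' ∧
    P.real {ω | (t : ℝ≥0∞) < BirthDeath.hitZero X ω} ≤
      BirthDeath.weight lam nu x *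
        Real.exp (-(t : ℝ) * (Real.sqrt lam - Real.sqrt nu) ^ 2) := by
  rw [BirthDeath.modBirth_mm1 hlam hnu, BirthDeath.modDeath_mm1 hlam hnu] at hY
  have hw := (BirthDeath.weight_facts hlam hnu).1
  have hP := BirthDeath.real_lt_hitZero_mm1_eq hlam hnu hX hY t
  refine ⟨hw, hP, ?_⟩
  rw [hP]
  exact mul_le_of_le_one_right
    (mul_nonneg (zero_le_one.trans (hw x)) (Real.exp_pos _).le)
    (BirthDeath.integral_inv_weight_mul_exp_le_one hlam hnu P' Y t)
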